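/- Let $K$ be a field and let $G$ be the $m\times n$ rectangular grid graph on the points $(x,y)$, $0\le x\le m-1$, $0\le y\le n-1$, with $(x,y)$ black if $x+y$ is even and white if $x+y$ is odd. Over a commutative ring $R$, the adjacency matrix of $G$ splits into linear maps $BW_R$ (from vectors supported on black points to vectors supported on white points) and $WB_R$ (from white to black). The elements of $\ker BW_{\mathbb Z/2}\cup\ker WB_{\mathbb Z/2}$ are called polarized $\mathbb Z/2$-harmonic functions. For such a function $u$, the active points are the points $p$ with $u(p)=1$. Two distinct active points are adjacent if they have a common neighbor $w$ in $G$ such that either they form a right angle at $w$ or they are the only active neighbors of $w$. A lifting of $u$ to $K$ is a vector over $K$ obtained by labelling the active points by $1$ and $-1$ so that adjacent active points receive opposite labels, and all other points by $0$ (the labels are first chosen as integers and then interpreted in $K$). Then: (i) For every polarized $\mathbb Z/2$-harmonic function $u$ the set of liftings of $u$ to $K$ is a class of the form $\{v,-v\}$, and $u\mapsto\{v,-v\}$ is a bijection from the polarized $\mathbb Z/2$-harmonic functions onto the classes $\{v,-v\}$ where $v$ is the image in $K$ of an integer vector in $\ker BW_{\mathbb Z}\cup\ker WB_{\mathbb Z}$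 with all coordinates in $\{0,1,-1\}$; in particular $v\in\ker BW_K\cup\ker WB_K$ and $v$ has coordinates in $\{0,1,-1\}$. (ii) If $K$ does not have characteristic $3$, this map is a bijection from the polarized $\mathbb Z/2$-harmonic functions onto the classes $\{v,-v\}$ of all vectors $v\in\ker BW_K\cup\ker WB_K$ whose coordinates are all equal to $0$, $1$ or $-1$. -/

import Mathlib

/-- The points of the `m × n` rectangular graph: pairs `(x, y)` of integers with
`0 ≤ x ≤ m - 1` and `0 ≤ y ≤ n - 1`. -/
abbrev RectPt (m n : ℕ) : Type := Fin m × Fin n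

/-- The `m × n` rectangular graph: two points are adjacent when they agree in one coordinate and
differ by exactly `1` in the other. -/
def rectGraph (m n : ℕ) : SimpleGraph (RectPt m n) where
  Adj p q :=
    (p.1 = q.1 ∧ (p.2.val + 1 = q.2.val ∨ q.2.val + 1 = p.2.val)) ∨
      (p.2 = q.2 ∧ (p.1.val + 1 = q.1.val ∨ q.1.val + 1 = p.1.val))
  symm := ⟨by
    rintro p q (⟨h, h'⟩ | ⟨h, h'⟩)
    · exact Or.inl ⟨h.symm, h'.symm⟩
    · exact Or.inr ⟨h.symm, h'.symm⟩⟩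
  loopless := ⟨by
    rintro p (⟨_, h⟩ | ⟨_, h⟩) <;> omega⟩

instance rectGraphDecidable (m n : ℕ) : DecidableRel (rectGraph m n).Adj := fun p q =>
  inferInstanceAs (Decidable
    ((p.1 = q.1 ∧ (p.2.val + 1 = q.2.val ∨ q.2.val + 1 = p.2.val)) ∨
      (p.2 = q.2 ∧ (p.1.val + 1 = q.1.val ∨ q.1.val + 1 = p.1.val))))

/-- A point `(x, y)` is black when `x + y` is even (so the origin is black). -/
def IsBlack {m n : ℕ} (p : RectPt m n) : Prop := Even (p.1.val + p.2.val)

/-- A point `(x, y)` is white when `x + y` is odd. -/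
def IsWhite {m n : ℕ} (p : RectPt m n) : Prop := Odd (p.1.val + p.2.val)

/-- Adjacent points have opposite colors. -/
theorem IsBlack.white_of_adj {m n : ℕ} {p q : RectPt m n} (hp : IsBlack p)
    (h : (rectGraph m n).Adj p q) : IsWhite q := by
  obtain ⟨k, hk⟩ := hp
  rcases h with ⟨h1, h2⟩ | ⟨h1, h2⟩
  · have := congrArg Fin.val h1
    rw [IsWhite, Nat.odd_iff]; omega
  · have := congrArg Fin.val h1
    rw [IsWhite, Nat.odd_iff]; omega

/-- Adjacent points have opposite colors. -/
theorem IsWhite.black_of_adj {m n : ℕ} {p q : RectPt m n} (hp : IsWhite p)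
    (h : (rectGraph m n).Adj p q) : IsBlack q := by
  obtain ⟨k, hk⟩ := hp
  rcases h with ⟨h1, h2⟩ | ⟨h1, h2⟩
  · have := congrArg Fin.val h1
    rw [IsBlack, Nat.even_iff]; omega
  · have := congrArg Fin.val h1
    rw [IsBlack, Nat.even_iff]; omega

/-- The vectors on the rectangular graph that are supported on the set of black points. -/
def blackSpace (R : Type*) [CommRing R] (m n : ℕ) : Submodule R (RectPt m n → R) where
  carrier := {v | ∀ p, ¬ IsBlack p → v p = 0}
  add_mem' := fun ha hb p hp => by simp [ha p hp, hb p hp]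
  zero_mem' := fun _ _ => rfl
  smul_mem' := fun c v hv p hp => by simp [hv p hp]

/-- The vectors on the rectangular graph that are supported on the set of white points. -/
def whiteSpace (R : Type*) [CommRing R] (m n : ℕ) : Submodule R (RectPt m n → R) where
  carrier := {v | ∀ p, ¬ IsWhite p → v p = 0}
  add_mem' := fun ha hb p hp => by simp [ha p hp, hb p hp]
  zero_mem' := fun _ _ => rfl
  smul_mem' := fun c v hv p hp => by simp [hv p hp]

/-- The adjacency matrix of the rectangular graph, interpreted as a linear map over `R`. -/
def adjMap (R : Type*) [CommRing R] (m n : ℕ) : (RectPt m n → R) →ₗ[R] (RectPt m n → R) :=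
  ((rectGraph m n).adjMatrix R).mulVecLin

theorem adjMap_black_mem (R : Type*) [CommRing R] (m n : ℕ) :
    ∀ v ∈ blackSpace R m n, adjMap R m n v ∈ whiteSpace R m n := by
  intro v hv p hp
  rw [adjMap, Matrix.mulVecLin_apply, SimpleGraph.adjMatrix_mulVec_apply]
  refine Finset.sum_eq_zero fun q hq => hv q fun hb => hp ?_
  rw [SimpleGraph.mem_neighborFinset] at hq
  exact hb.white_of_adj hq.symm

theorem adjMap_white_mem (R : Type*) [CommRing R] (m n : ℕ) :
    ∀ v ∈ whiteSpace R m n, adjMap R m n v ∈ blackSpace R m n := by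
  intro v hv p hp
  rw [adjMap, Matrix.mulVecLin_apply, SimpleGraph.adjMatrix_mulVec_apply]
  refine Finset.sum_eq_zero fun q hq => hv q fun hb => hp ?_
  rw [SimpleGraph.mem_neighborFinset] at hq
  exact hb.black_of_adj hq.symm

/-- The black-to-white part of the adjacency matrix. -/
def mapBW (R : Type*) [CommRing R] (m n : ℕ) : blackSpace R m n →ₗ[R] whiteSpace R m n :=
  (adjMap R m n).restrict (adjMap_black_mem R m n)

/-- The white-to-black part of the adjacency matrix. -/
def mapWB (R : Type*) [CommRing R] (m n : ℕ) : whiteSpace R m n →ₗ[R] blackSpace R m n :=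
  (adjMap R m n).restrict (adjMap_white_mem R m n)

/-- The kernel of `BW`, as a space of functions on all points, supported on the black ones. -/
def kerBW (R : Type*) [CommRing R] (m n : ℕ) : Submodule R (RectPt m n → R) :=
  (LinearMap.ker (mapBW R m n)).map (blackSpace R m n).subtype

/-- The kernel of `WB`, as a space of functions on all points, supported on the white ones. -/
def kerWB (R : Type*) [CommRing R] (m n : ℕ) : Submodule R (RectPt m n → R) :=
  (LinearMap.ker (mapWB R m n)).map (whiteSpace R m n).subtype

/-- The union of the kernels of `BW` and `WB` over `R`. For `R = ZMod 2` its elements are the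
polarized `ℤ/2`-harmonic functions. -/
def polarizedKer (R : Type*) [CommRing R] (m n : ℕ) : Set (RectPt m n → R) :=
  (kerBW R m n : Set (RectPt m n → R)) ∪ (kerWB R m n : Set (RectPt m n → R))

/-- The active points of a `ℤ/2`-valued function `u` are those where it takes the value `1`. -/
def IsActive {m n : ℕ} (u : RectPt m n → ZMod 2) (p : RectPt m n) : Prop := u p = 1

/-- The segments from `w` to `p` and from `w` to `q` are orthogonal. -/
def RightAngleAt {m n : ℕ} (w p q : RectPt m n) : Prop :=
  ((p.1.val : ℤ) - w.1.val) * ((q.1.val : ℤ) - w.1.val) +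
    ((p.2.val : ℤ) - w.2.val) * ((q.2.val : ℤ) - w.2.val) = 0

/-- The adjacency relation between active points of `u`: two distinct active points are adjacent
when they have a common neighbor `w` such that they either form a right angle with `w`, or are
the only active neighbors of `w`. -/
def ActiveAdj {m n : ℕ} (u : RectPt m n → ZMod 2) (p q : RectPt m n) : Prop :=
  p ≠ q ∧ IsActive u p ∧ IsActive u q ∧
    ∃ w, (rectGraph m n).Adj w p ∧ (rectGraph m n).Adj w q ∧
      (RightAngleAt w p q ∨ ∀ r, (rectGraph m n).Adj w r → IsActive u r → r = p ∨ r = q)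

/-- `s` labels the active points of `u` alternately by `1` and `-1` (adjacent active points get
opposite labels), and is `0` at all other points. -/
structure IsAlternating {m n : ℕ} (u : RectPt m n → ZMod 2) (s : RectPt m n → ℤ) : Prop where
  inactive : ∀ p, ¬ IsActive u p → s p = 0
  active : ∀ p, IsActive u p → s p = 1 ∨ s p = -1
  alternate : ∀ p q, ActiveAdj u p q → s q = -s p

/-- An integer vector, interpreted as a vector over `K`. -/
def castVec (K : Type*) [CommRing K] {m n : ℕ} (s : RectPt m n → ℤ) : RectPt m n → K :=
  fun p => (s p : K)

/-- The set of all liftings of `u` to a vector over `K`. -/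
def liftings (K : Type*) [CommRing K] {m n : ℕ} (u : RectPt m n → ZMod 2) :
    Set (RectPt m n → K) :=
  {v | ∃ s : RectPt m n → ℤ, IsAlternating u s ∧ v = castVec K s}

/-- The coordinates of `v` are all equal to `0`, `1` or `-1`. -/
def HasSignCoords {K : Type*} [CommRing K] {m n : ℕ} (v : RectPt m n → K) : Prop :=
  ∀ p, v p = 0 ∨ v p = 1 ∨ v p = -1

/-- The classes `{v, -v}` of vectors `v` in the kernel of `BW` or of `WB` over `K` with
coordinates equal to `0`, `1` or `-1`. -/
def signClasses (K : Type*) [CommRing K] (m n : ℕ) : Set (Set (RectPt m n → K)) :=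
  {C | ∃ v ∈ polarizedKer K m n, HasSignCoords v ∧ C = {v, -v}}

/-- The classes `{v, -v}` of vectors `v` over `K` that come from integer vectors in the kernel of
`BW` or of `WB` with coordinates equal to `0`, `1` or `-1`. -/
def integralSignClasses (K : Type*) [CommRing K] (m n : ℕ) : Set (Set (RectPt m n → K)) :=
  {C | ∃ s ∈ polarizedKer ℤ m n, HasSignCoords s ∧ C = {castVec K s, -castVec K s}}

/-! Harmonicity on the grid is a discrete wave equation with `y` as time, so d'Alembert's formula
solves it. A polarized harmonic `v`, extended by zero, has the form `v (x, y) = (-1)^y (F (x + y +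
2) - F (x - y))`, where vanishing on the frame around the rectangle makes `F` even with periods `2
(m + 1)` and `2 (n + 1)` (`exists_profile`).

Conversely, every difference `F z - F z'` with `z ≡ z' mod 2` is zero or, up to sign, a coordinate
of `v` (`IsProfile.sub_mem`). If the coordinates are `0, 1, -1` and `3 ≠ 0`, then `F` takes only
values `a` and `a + 1` on the relevant parity class. Replacing them by the integers `0` and `1`
shows that `v` is the image of an integral harmonic sign vector (`exists_indicator_profile`,
`exists_integral_lift`). Since `3 ≠ 0` in `ZMod 2`, this applies to every `u`.

Liftings are then the integral harmonic sign vectors reducing to `u`: such vectors alternate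
(`isAlternating_castVec`), and alternating labellings are harmonic (`IsAlternating.adjMap_eq_zero`).
Two of them agree up to sign, because their 0-1 profiles are equal or complementary on the parity
class (`eq_or_eq_neg_of_emod_two_eq`). -/

/-! ### Extension by zero and the kernels -/

/-- The extension of a vector on the rectangle to `ℤ × ℤ` by zero. -/
def zeroExt {R : Type*} [CommRing R] {m n : ℕ} (v : RectPt m n → R) (a b : ℤ) : R :=
  ∑ q : RectPt m n, if (q.1.val : ℤ) = a ∧ (q.2.val : ℤ) = b then v q else 0

theorem zeroExt_apply {R : Type*} [CommRing R] {m n : ℕ} (v : RectPt m n → R) {a b : ℤ}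
    (p : RectPt m n) (ha : (p.1.val : ℤ) = a) (hb : (p.2.val : ℤ) = b) :
    zeroExt v a b = v p := by
  rw [zeroExt, Finset.sum_eq_single p, if_pos ⟨ha, hb⟩]
  · intro q _ hq
    rw [if_neg]
    rintro ⟨h1, h2⟩
    exact hq (Prod.ext (Fin.ext (by omega)) (Fin.ext (by omega)))
  · simp

theorem zeroExt_of_outside {R : Type*} [CommRing R] {m n : ℕ} (v : RectPt m n → R) {a b : ℤ}
    (h : a < 0 ∨ (m : ℤ) ≤ a ∨ b < 0 ∨ (n : ℤ) ≤ b) : zeroExt v a b = 0 := by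
  refine Finset.sum_eq_zero fun q _ => if_neg ?_
  rintro ⟨h1, h2⟩
  have := q.1.isLt
  have := q.2.isLt
  omega

theorem exists_rectPt_or_outside (m n : ℕ) (a b : ℤ) :
    (∃ p : RectPt m n, (p.1.val : ℤ) = a ∧ (p.2.val : ℤ) = b) ∨
      (a < 0 ∨ (m : ℤ) ≤ a ∨ b < 0 ∨ (n : ℤ) ≤ b) := by
  by_cases h : a < 0 ∨ (m : ℤ) ≤ a ∨ b < 0 ∨ (n : ℤ) ≤ b
  · exact Or.inr h
  · push Not at h
    exact Or.inl ⟨(⟨a.toNat, by omega⟩, ⟨b.toNat, by omega⟩), by simp; omega, by simp; omega⟩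

theorem adjMap_apply_eq_sum (R : Type*) [CommRing R] {m n : ℕ} (v : RectPt m n → R)
    (p : RectPt m n) :
    adjMap R m n v p = ∑ q ∈ (rectGraph m n).neighborFinset p, v q := by
  rw [adjMap, Matrix.mulVecLin_apply, SimpleGraph.adjMatrix_mulVec_apply]

theorem adjMap_eq_zeroExt (R : Type*) [CommRing R] {m n : ℕ} (v : RectPt m n → R)
    (p : RectPt m n) :
    adjMap R m n v p =
      zeroExt v (p.1.val + 1) p.2.val + zeroExt v (p.1.val - 1) p.2.val +
        zeroExt v p.1.val (p.2.val + 1) + zeroExt v p.1.val (p.2.val - 1) := by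
  rw [adjMap_apply_eq_sum]
  simp only [zeroExt, ← Finset.sum_add_distrib]
  rw [SimpleGraph.neighborFinset_eq_filter, Finset.sum_filter]
  refine Finset.sum_congr rfl fun q _ => ?_
  have key : (rectGraph m n).Adj p q ↔
      ((q.1.val : ℤ) = p.1.val + 1 ∧ (q.2.val : ℤ) = p.2.val) ∨
      ((q.1.val : ℤ) = p.1.val - 1 ∧ (q.2.val : ℤ) = p.2.val) ∨
      ((q.1.val : ℤ) = p.1.val ∧ (q.2.val : ℤ) = p.2.val + 1) ∨
      ((q.1.val : ℤ) = p.1.val ∧ (q.2.val : ℤ) = p.2.val - 1) := by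
    simp only [rectGraph, Fin.ext_iff]
    omega
  simp only [key]
  by_cases h1 : (q.1.val : ℤ) = p.1.val + 1 ∧ (q.2.val : ℤ) = p.2.val
  · rw [if_pos (by tauto), if_pos h1, if_neg (by omega), if_neg (by omega), if_neg (by omega)]
    ring
  by_cases h2 : (q.1.val : ℤ) = p.1.val - 1 ∧ (q.2.val : ℤ) = p.2.val
  · rw [if_pos (by tauto), if_pos h2, if_neg (by omega), if_neg (by omega), if_neg (by omega)]
    ring
  by_cases h3 : (q.1.val : ℤ) = p.1.val ∧ (q.2.val : ℤ) = p.2.val + 1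
  · rw [if_pos (by tauto), if_pos h3, if_neg (by omega), if_neg (by omega), if_neg (by omega)]
    ring
  by_cases h4 : (q.1.val : ℤ) = p.1.val ∧ (q.2.val : ℤ) = p.2.val - 1
  · rw [if_pos (by tauto), if_pos h4, if_neg (by omega), if_neg (by omega), if_neg (by omega)]
    ring
  rw [if_neg (by tauto), if_neg h1, if_neg h2, if_neg h3, if_neg h4]
  ring

/-- `v` vanishes at the points `(x, y)` where `x + y` is not congruent to `c` modulo `2`. -/
def SupportedOnParity {R : Type*} [CommRing R] {m n : ℕ} (c : ℤ) (v : RectPt m n → R) : Prop :=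
  ∀ p, ((p.1.val : ℤ) + p.2.val + c) % 2 ≠ 0 → v p = 0

/-- Letting the parity `c` vary treats the black and white kernels at once. -/
theorem mem_polarizedKer_iff {R : Type*} [CommRing R] {m n : ℕ} {v : RectPt m n → R} :
    v ∈ polarizedKer R m n ↔ adjMap R m n v = 0 ∧ ∃ c, SupportedOnParity c v := by
  have hB : v ∈ kerBW R m n ↔ adjMap R m n v = 0 ∧ v ∈ blackSpace R m n := by
    simp only [kerBW, Submodule.mem_map, LinearMap.mem_ker]
    constructor
    · rintro ⟨⟨x, hx⟩, h, rfl⟩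
      exact ⟨congrArg Subtype.val h, hx⟩
    · rintro ⟨h, hv⟩
      exact ⟨⟨v, hv⟩, Subtype.ext h, rfl⟩
  have hW : v ∈ kerWB R m n ↔ adjMap R m n v = 0 ∧ v ∈ whiteSpace R m n := by
    simp only [kerWB, Submodule.mem_map, LinearMap.mem_ker]
    constructor
    · rintro ⟨⟨x, hx⟩, h, rfl⟩
      exact ⟨congrArg Subtype.val h, hx⟩
    · rintro ⟨h, hv⟩
      exact ⟨⟨v, hv⟩, Subtype.ext h, rfl⟩
  rw [polarizedKer, Set.mem_union, SetLike.mem_coe, SetLike.mem_coe, hB, hW]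
  constructor
  · rintro (⟨h, hv⟩ | ⟨h, hv⟩)
    · refine ⟨h, 0, fun p hp => hv p ?_⟩
      rw [IsBlack, Nat.even_iff]
      omega
    · refine ⟨h, 1, fun p hp => hv p ?_⟩
      rw [IsWhite, Nat.odd_iff]
      omega
  · rintro ⟨h, c, hc⟩
    rcases Int.emod_two_eq_zero_or_one c with h0 | h1
    · refine Or.inl ⟨h, fun p hp => hc p ?_⟩
      rw [IsBlack, Nat.even_iff] at hp
      omega
    · refine Or.inr ⟨h, fun p hp => hc p ?_⟩
      rw [IsWhite, Nat.odd_iff] at hp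
      omega

theorem adjMap_castVec (K : Type*) [CommRing K] {m n : ℕ} (s : RectPt m n → ℤ) :
    adjMap K m n (castVec K s) = castVec K (adjMap ℤ m n s) := by
  funext p
  simp [castVec, adjMap_apply_eq_sum]

theorem castVec_mem_polarizedKer (K : Type*) [CommRing K] {m n : ℕ} {s : RectPt m n → ℤ}
    (hs : s ∈ polarizedKer ℤ m n) : castVec K s ∈ polarizedKer K m n := by
  rw [mem_polarizedKer_iff] at hs ⊢
  obtain ⟨h, c, hc⟩ := hs
  refine ⟨?_, c, fun p hp => ?_⟩
  · rw [adjMap_castVec, h]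
    funext p
    simp [castVec]
  · simp [castVec, hc p hp]

theorem HasSignCoords.castVec (K : Type*) [CommRing K] {m n : ℕ} {s : RectPt m n → ℤ}
    (hs : HasSignCoords s) : HasSignCoords (castVec K s) := by
  intro p
  rcases hs p with h | h | h <;> simp [_root_.castVec, h]

/-! ### Travelling waves and their boundary values -/

/-- An even function on `ℤ` with the periods `2 (m + 1)` and `2 (n + 1)`. -/
structure IsProfile {R : Type*} (m n : ℕ) (F : ℤ → R) : Prop where
  even : ∀ z, F (-z) = F z
  periodic_width : Function.Periodic F (2 * (m + 1))
  periodic_height : Function.Periodic F (2 * (n + 1))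

theorem IsProfile.comp {R S : Type*} {m n : ℕ} {F : ℤ → R} (hF : IsProfile m n F) (φ : R → S) :
    IsProfile m n (fun z => φ (F z)) :=
  ⟨fun z => congrArg φ (hF.even z), fun z => congrArg φ (hF.periodic_width z),
    fun z => congrArg φ (hF.periodic_height z)⟩

theorem IsProfile.sub {R : Type*} [CommRing R] {m n : ℕ} {F G : ℤ → R} (hF : IsProfile m n F)
    (hG : IsProfile m n G) : IsProfile m n (fun z => F z - G z) :=
  ⟨fun z => by simp only [hF.even, hG.even],
    fun z => by simp only [hF.periodic_width z, hG.periodic_width z],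
    fun z => by simp only [hF.periodic_height z, hG.periodic_height z]⟩

/-- The solution on `ℤ × ℤ` of the harmonicity equation with the travelling wave `F`. -/
def planeWave {R : Type*} [CommRing R] (F : ℤ → R) (a b : ℤ) : R :=
  if b % 2 = 0 then F (a + b + 2) - F (a - b) else F (a - b) - F (a + b + 2)

/-- The restriction of `planeWave F` to the rectangle. -/
def rectWave {R : Type*} [CommRing R] (m n : ℕ) (F : ℤ → R) : RectPt m n → R :=
  fun p => planeWave F p.1.val p.2.val

/-- The terms at `(a ± 1, b)` have the same arguments `a + b + 2 ± 1` and `a - b ± 1` as those at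
`(a, b ± 1)`, with the opposite sign. -/
theorem planeWave_harmonic {R : Type*} [CommRing R] (F : ℤ → R) (a b : ℤ) :
    planeWave F (a + 1) b + planeWave F (a - 1) b + planeWave F a (b + 1) +
      planeWave F a (b - 1) = 0 := by
  have e1 : a + 1 + b + 2 = a + (b + 1) + 2 := by ring
  have e2 : a - 1 + b + 2 = a + (b - 1) + 2 := by ring
  have e3 : a + 1 - b = a - (b - 1) := by ring
  have e4 : a - 1 - b = a - (b + 1) := by ring
  simp only [planeWave, e1, e2, e3, e4]
  by_cases h : b % 2 = 0
  · rw [if_pos h, if_pos h, if_neg (by omega), if_neg (by omega)]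
    ring
  · rw [if_neg h, if_neg h, if_pos (by omega), if_pos (by omega)]
    ring

theorem planeWave_eq_zero {R : Type*} [CommRing R] {F : ℤ → R} {a b : ℤ}
    (h : F (a + b + 2) = F (a - b)) : planeWave F a b = 0 := by
  simp [planeWave, h]

theorem planeWave_left {R : Type*} [CommRing R] {F : ℤ → R} (he : ∀ z, F (-z) = F z) (b : ℤ) :
    planeWave F (-1) b = 0 := by
  refine planeWave_eq_zero ?_
  rw [← he]
  congr 1
  ring

theorem planeWave_right {R : Type*} [CommRing R] {F : ℤ → R} (he : ∀ z, F (-z) = F z) {m : ℤ}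
    (hp : Function.Periodic F (2 * (m + 1))) (b : ℤ) : planeWave F m b = 0 := by
  refine planeWave_eq_zero ?_
  rw [← he (m - b), ← hp (-(m - b))]
  congr 1
  ring

theorem planeWave_top {R : Type*} [CommRing R] {F : ℤ → R} {n : ℤ}
    (hp : Function.Periodic F (2 * (n + 1))) (a : ℤ) : planeWave F a n = 0 := by
  refine planeWave_eq_zero ?_
  rw [← hp (a - n)]
  congr 1
  ring

theorem planeWave_bottom {R : Type*} [CommRing R] (F : ℤ → R) (a : ℤ) :
    planeWave F a (-1) = 0 := by
  refine planeWave_eq_zero ?_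
  congr 1
  ring

/-- The wave vanishes on the frame one step outside the rectangle: evenness gives column `-1`,
evenness and the width period give column `m`, the height period gives row `n`, and row `-1` is
automatic. -/
theorem IsProfile.zeroExt_rectWave {R : Type*} [CommRing R] {m n : ℕ} {F : ℤ → R}
    (hF : IsProfile m n F) {a b : ℤ} (ha : -1 ≤ a) (ha' : a ≤ m) (hb : -1 ≤ b) (hb' : b ≤ n) :
    zeroExt (rectWave m n F) a b = planeWave F a b := by
  rcases exists_rectPt_or_outside m n a b with ⟨p, rfl, rfl⟩ | h
  · rw [zeroExt_apply _ p rfl rfl, rectWave]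
  · rw [zeroExt_of_outside _ h]
    have h' : a = -1 ∨ a = m ∨ b = -1 ∨ b = n := by omega
    rcases h' with rfl | rfl | rfl | rfl
    · exact (planeWave_left hF.even b).symm
    · exact (planeWave_right hF.even hF.periodic_width b).symm
    · exact (planeWave_bottom F a).symm
    · exact (planeWave_top hF.periodic_height a).symm

theorem IsProfile.adjMap_rectWave {R : Type*} [CommRing R] {m n : ℕ} {F : ℤ → R}
    (hF : IsProfile m n F) : adjMap R m n (rectWave m n F) = 0 := by
  funext p
  have h1 := p.1.isLt
  have h2 := p.2.isLt
  rw [adjMap_eq_zeroExt, hF.zeroExt_rectWave, hF.zeroExt_rectWave, hF.zeroExt_rectWave,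
    hF.zeroExt_rectWave, planeWave_harmonic]
  · rfl
  all_goals omega

theorem supportedOnParity_rectWave {R : Type*} [CommRing R] {m n : ℕ} {F : ℤ → R} {c : ℤ} {k : R}
    (hk : ∀ z, (z + c) % 2 ≠ 0 → F z = k) : SupportedOnParity c (rectWave m n F) := by
  intro p hp
  refine planeWave_eq_zero ?_
  rw [hk _ (by omega), hk _ (by omega)]

/-! ### Folding the integers onto an interval -/

/-- Every integer is, up to sign and multiples of `2 L`, a unique element of `[0, L]`. -/
theorem exists_fold {L : ℤ} (hL : 0 < L) (z : ℤ) :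
    ∃ a, 0 ≤ a ∧ a ≤ L ∧ ∃ k, z = a + k * (2 * L) ∨ z = -a + k * (2 * L) := by
  have h0 := Int.emod_nonneg z (b := 2 * L) (by omega)
  have h1 := Int.emod_lt_of_pos z (b := 2 * L) (by omega)
  have h2 := Int.emod_add_mul_ediv z (2 * L)
  by_cases h : z % (2 * L) ≤ L
  · exact ⟨z % (2 * L), h0, h, z / (2 * L), Or.inl (by linarith)⟩
  · exact ⟨2 * L - z % (2 * L), by omega, by omega, z / (2 * L) + 1, Or.inr (by linarith)⟩

theorem fold_unique {L : ℤ} {a b k : ℤ} (ha : 0 ≤ a) (ha' : a ≤ L) (hb : 0 ≤ b)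
    (hb' : b ≤ L) (hL : 0 < L) (h : a = b + k * (2 * L) ∨ a = -b + k * (2 * L)) : a = b := by
  have hk1 : -1 < k := by
    by_contra hk
    have : k * (2 * L) ≤ -1 * (2 * L) := mul_le_mul_of_nonneg_right (by omega) (by omega)
    omega
  have hk2 : k < 2 := by
    by_contra hk
    have : 2 * (2 * L) ≤ k * (2 * L) := mul_le_mul_of_nonneg_right (by omega) (by omega)
    omega
  have : k = 0 ∨ k = 1 := by omega
  rcases this with rfl | rfl <;> omega

theorem apply_fold {R : Type*} {F : ℤ → R} (he : ∀ z, F (-z) = F z) {L : ℤ}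
    (hp : Function.Periodic F (2 * L)) {a z k : ℤ}
    (h : z = a + k * (2 * L) ∨ z = -a + k * (2 * L)) : F z = F a := by
  have h' : ∀ x, F (x + k * (2 * L)) = F x := fun x => by simpa using hp.int_mul k x
  rcases h with rfl | rfl
  · exact h' a
  · rw [h', he]

/-- Fold `z` and `z'` into `[0, L]` with `L = min m n + 1`. Folding preserves parity, and the
smaller side is chosen so that the grid point realizing the difference lies in the rectangle. -/
theorem IsProfile.sub_mem {R : Type*} [CommRing R] {m n : ℕ} {F : ℤ → R} (hF : IsProfile m n F)
    {S : Set R} (h0 : 0 ∈ S) (hneg : ∀ r ∈ S, -r ∈ S) (hS : ∀ p, rectWave m n F p ∈ S) {z z' : ℤ}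
    (hz : (z + z') % 2 = 0) : F z - F z' ∈ S := by
  obtain ⟨L, hL, hLm, hLn, hp⟩ : ∃ L : ℤ, 0 < L ∧ L ≤ m + 1 ∧ L ≤ n + 1 ∧
      Function.Periodic F (2 * L) := by
    rcases le_total m n with h | h
    · exact ⟨m + 1, by omega, by omega, by omega, hF.periodic_width⟩
    · exact ⟨n + 1, by omega, by omega, by omega, hF.periodic_height⟩
  have main : ∀ a b : ℤ, 0 ≤ a → a < b → b ≤ L → (a + b) % 2 = 0 → F b - F a ∈ S := by
    intro a b ha hab hb hpar
    -- The point solves `x + y + 2 = b` and `x - y = a`.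
    have h := hS (⟨((a + b) / 2 - 1).toNat, by omega⟩, ⟨((b - a) / 2 - 1).toNat, by omega⟩)
    have e1 : ((((a + b) / 2 - 1).toNat : ℕ) : ℤ) = (a + b) / 2 - 1 := by omega
    have e2 : ((((b - a) / 2 - 1).toNat : ℕ) : ℤ) = (b - a) / 2 - 1 := by omega
    simp only [rectWave, planeWave, e1, e2] at h
    rw [show (a + b) / 2 - 1 + ((b - a) / 2 - 1) + 2 = b by omega,
      show (a + b) / 2 - 1 - ((b - a) / 2 - 1) = a by omega] at h
    split_ifs at h
    · exact h
    · simpa using hneg _ h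
  obtain ⟨a, ha, ha', k, hk⟩ := exists_fold hL z
  obtain ⟨b, hb, hb', l, hl⟩ := exists_fold hL z'
  rw [apply_fold hF.even hp hk, apply_fold hF.even hp hl]
  have e1 : k * (2 * L) = 2 * (k * L) := by ring
  have e2 : l * (2 * L) = 2 * (l * L) := by ring
  rw [e1] at hk
  rw [e2] at hl
  have hab : (a + b) % 2 = 0 := by omega
  rcases lt_trichotomy a b with h | h | h
  · simpa using hneg _ (main a b ha h hb' hab)
  · simpa [h] using h0
  · exact main b a hb h ha' (by omega)

/-- The last clause records that folding preserves parity, so vanishing of `f` on the nonnegative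
integers of one parity passes to `F`. -/
theorem exists_even_periodic {R : Type*} {L : ℤ} (hL : 0 < L) (f : ℤ → R) :
    ∃ F : ℤ → R, (∀ z, F (-z) = F z) ∧ Function.Periodic F (2 * L) ∧
      (∀ z, 0 ≤ z → z ≤ L → F z = f z) ∧ ∀ z, ∃ a, 0 ≤ a ∧ (z + a) % 2 = 0 ∧ F z = f a := by
  choose g hg0 hgL hg using exists_fold hL
  have huniq : ∀ z z', (∃ k, z = z' + k * (2 * L) ∨ z = -z' + k * (2 * L)) → g z = g z' := by
    rintro z z' ⟨k, hk⟩
    obtain ⟨i, hi⟩ := hg z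
    obtain ⟨j, hj⟩ := hg z'
    have : ∃ l, g z = g z' + l * (2 * L) ∨ g z = -g z' + l * (2 * L) := by
      rcases hk with hk | hk <;> rcases hi with hi | hi <;> rcases hj with hj | hj
      · exact ⟨j + k - i, Or.inl (by linarith)⟩
      · exact ⟨j + k - i, Or.inr (by linarith)⟩
      · exact ⟨i - j - k, Or.inr (by linarith)⟩
      · exact ⟨i - j - k, Or.inl (by linarith)⟩
      · exact ⟨k - j - i, Or.inr (by linarith)⟩
      · exact ⟨k - j - i, Or.inl (by linarith)⟩
      · exact ⟨i + j - k, Or.inl (by linarith)⟩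
      · exact ⟨i + j - k, Or.inr (by linarith)⟩
    obtain ⟨l, hl⟩ := this
    exact fold_unique (hg0 z) (hgL z) (hg0 z') (hgL z') hL hl
  refine ⟨fun z => f (g z), fun z => ?_, fun z => ?_, fun z h0 h1 => ?_, fun z => ?_⟩
  · exact congrArg f (huniq _ _ ⟨0, Or.inr (by ring)⟩)
  · exact congrArg f (huniq _ _ ⟨1, Or.inl (by ring)⟩)
  · obtain ⟨k, hk⟩ := hg z
    refine congrArg f (fold_unique (hg0 z) (hgL z) h0 h1 hL ?_ (k := ?_))
    · exact if z = g z + k * (2 * L) then -k else k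
    · split_ifs with h
      · exact Or.inl (by linarith)
      · exact Or.inr (by rcases hk with hk | hk; exacts [absurd hk h, by linarith])
  · obtain ⟨k, hk⟩ := hg z
    refine ⟨g z, hg0 z, ?_, rfl⟩
    have e1 : k * (2 * L) = 2 * (k * L) := by ring
    rw [e1] at hk
    omega

/-! ### D'Alembert's formula -/

/-- Partial sums of `V` with step two. -/
def stepTwoSum {R : Type*} [CommRing R] (V : ℤ → R) : ℕ → R
  | 0 => 0
  | 1 => 0
  | k + 2 => stepTwoSum V k + V k

theorem stepTwoSum_eq_zero {R : Type*} [CommRing R] {V : ℤ → R} {c : ℤ}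
    (hV : ∀ a, (a + c) % 2 ≠ 0 → V a = 0) :
    ∀ k : ℕ, ((k : ℤ) + c) % 2 ≠ 0 → stepTwoSum V k = 0
  | 0, _ => rfl
  | 1, _ => rfl
  | k + 2, h => by
    have h' : ((k : ℤ) + c) % 2 ≠ 0 := by push_cast at h; omega
    rw [stepTwoSum, stepTwoSum_eq_zero hV k h', hV k h', add_zero]

/-- D'Alembert's formula for harmonic vectors on the rectangle. -/
theorem exists_profile {R : Type*} [CommRing R] {m n : ℕ} {v : RectPt m n → R} {c : ℤ}
    (hv : adjMap R m n v = 0) (hc : SupportedOnParity c v) :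
    ∃ F : ℤ → R, IsProfile m n F ∧ (∀ z, (z + c) % 2 ≠ 0 → F z = 0) ∧ v = rectWave m n F := by
  have hV : ∀ a, (a + c) % 2 ≠ 0 → zeroExt v a 0 = 0 := by
    intro a ha
    rcases exists_rectPt_or_outside m n a 0 with ⟨p, h1, h2⟩ | h
    · rw [zeroExt_apply v p h1 h2, hc p (by omega)]
    · exact zeroExt_of_outside v h
  -- On row `0` the wave equals `F (a + 2) - F a`, so summing that row with step two determines `F`
  -- on `[0, m + 1]`.
  obtain ⟨F, he, hp, hf, hpar⟩ := exists_even_periodic (L := (m : ℤ) + 1) (by omega)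
    (fun z => stepTwoSum (fun a => zeroExt v a 0) z.toNat)
  have hstep : ∀ a : ℤ, -1 ≤ a → a ≤ m → zeroExt v a 0 = planeWave F a 0 := by
    intro a ha ha'
    have h' : a = -1 ∨ a = m ∨ (0 ≤ a ∧ a + 2 ≤ m + 1) := by omega
    rcases h' with rfl | rfl | ⟨h0, h1⟩
    · rw [planeWave_left he, zeroExt_of_outside]
      omega
    · rw [planeWave_right he hp, zeroExt_of_outside]
      omega
    · lift a to ℕ using h0
      have e : ((a : ℤ) + 0 + 2).toNat = a + 2 := by omega
      rw [planeWave, if_pos (by norm_num), hf _ (by omega) (by omega), hf _ (by omega) (by omega),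
        e, stepTwoSum]
      simp
  -- The recursion is of second order in the row index, so two consecutive rows are carried along,
  -- starting with rows `-1` and `0`.
  have hext : ∀ k : ℕ, k ≤ n → ∀ a : ℤ, -1 ≤ a → a ≤ m →
      zeroExt v a (k - 1) = planeWave F a (k - 1) ∧ zeroExt v a k = planeWave F a k := by
    intro k
    induction k with
    | zero =>
      intro _ a ha ha'
      refine ⟨?_, by simpa using hstep a ha ha'⟩
      rw [Nat.cast_zero, zero_sub, planeWave_bottom, zeroExt_of_outside]
      omega
    | succ k ih =>
      intro hk a ha ha'
      have ih := ih (by omega)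
      rw [Nat.cast_add_one, add_sub_cancel_right]
      refine ⟨(ih a ha ha').2, ?_⟩
      have h' : a = -1 ∨ a = m ∨ (0 ≤ a ∧ a < m) := by omega
      rcases h' with rfl | rfl | ⟨h0, h1⟩
      · rw [planeWave_left he, zeroExt_of_outside]
        omega
      · rw [planeWave_right he hp, zeroExt_of_outside]
        omega
      · have hsum := congrFun hv (⟨a.toNat, by omega⟩, ⟨k, by omega⟩)
        rw [adjMap_eq_zeroExt] at hsum
        simp only [Int.toNat_of_nonneg h0, Pi.zero_apply] at hsum
        rw [(ih _ (by omega) (by omega)).2, (ih _ (by omega) (by omega)).2,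
          (ih _ ha ha').1] at hsum
        have := planeWave_harmonic F a k
        linear_combination hsum - this
  have hper : Function.Periodic F (2 * ((n : ℤ) + 1)) := by
    -- Row `n` lies outside the rectangle, so `v` and hence the wave vanish there; this yields the
    -- height period.
    have hodd : ∀ a : ℤ, 0 ≤ a → a ≤ m + 1 → F (a + (n + 1)) - F (a - (n + 1)) = 0 := by
      intro a h0 h1
      have h := (hext n le_rfl (a - 1) (by omega) (by omega)).2
      rw [zeroExt_of_outside _ (by omega), planeWave] at h
      rw [show a - 1 + (n : ℤ) + 2 = a + (n + 1) by ring,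
        show a - 1 - (n : ℤ) = a - (n + 1) by ring] at h
      split_ifs at h
      · exact h.symm
      · linear_combination h
    have hall : ∀ z, F (z + (n + 1)) - F (z - (n + 1)) = 0 := by
      intro z
      obtain ⟨a, h0, h1, k, hk⟩ := exists_fold (L := (m : ℤ) + 1) (by omega) z
      have ha := hodd a h0 h1
      have hk' : ∀ x, F (x + k * (2 * ((m : ℤ) + 1))) = F x := fun x => by
        simpa using hp.int_mul k x
      rcases hk with rfl | rfl
      · rw [add_right_comm, add_sub_right_comm, hk', hk', ha]
      · rw [add_right_comm, add_sub_right_comm, hk', hk', ← he (-a + (n + 1)),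
          ← he (-a - (n + 1)), show -(-a + ((n : ℤ) + 1)) = a - (n + 1) by ring,
          show -(-a - ((n : ℤ) + 1)) = a + (n + 1) by ring]
        linear_combination -ha
    intro z
    have h := hall (z + (n + 1))
    rw [show z + ((n : ℤ) + 1) + (n + 1) = z + 2 * (n + 1) by ring,
      show z + ((n : ℤ) + 1) - (n + 1) = z by ring] at h
    exact sub_eq_zero.mp h
  refine ⟨F, ⟨he, hp, hper⟩, fun z hz => ?_, funext fun p => ?_⟩
  · obtain ⟨a, h0, ha, hF⟩ := hpar z
    rw [hF]
    exact stepTwoSum_eq_zero hV _ (by omega)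
  · have h1 := p.1.isLt
    have h2 := p.2.isLt
    rw [← zeroExt_apply v p rfl rfl, rectWave,
      (hext p.2.val (by omega) p.1.val (by omega) (by omega)).2]

/-! ### Integral lifts and uniqueness up to sign -/

/-- A harmonic vector with coordinates `0`, `1`, `-1` is given by a profile with values in
`{0, 1}`. -/
theorem exists_indicator_profile {R : Type*} [CommRing R] [Nontrivial R] (h3 : (3 : R) ≠ 0)
    {m n : ℕ} {v : RectPt m n → R} {c : ℤ} (hv : adjMap R m n v = 0)
    (hc : SupportedOnParity c v) (hs : HasSignCoords v) :
    ∃ G : ℤ → ℤ, IsProfile m n G ∧ (∀ z, G z = 0 ∨ G z = 1) ∧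
      (∀ z, (z + c) % 2 ≠ 0 → ∀ z', (z' + c) % 2 ≠ 0 → G z = G z') ∧
      v = castVec R (rectWave m n G) := by
  obtain ⟨F, hF, hoff, rfl⟩ := exists_profile hv hc
  have hdiff : ∀ z, (z + c) % 2 = 0 → ∀ z', (z' + c) % 2 = 0 →
      F z - F z' = 0 ∨ F z - F z' = 1 ∨ F z - F z' = -1 := by
    intro z hz z' hz'
    refine hF.sub_mem (S := {r | r = 0 ∨ r = 1 ∨ r = -1}) (Or.inl rfl) ?_ hs (by omega)
    rintro r (rfl | rfl | rfl) <;> simp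
  obtain ⟨a, ha⟩ : ∃ a, ∀ z, (z + c) % 2 = 0 → F z = a ∨ F z = a + 1 := by
    by_cases hlow : ∃ z, (z + c) % 2 = 0 ∧ F z = F c - 1
    · obtain ⟨z₀, hz₀, h₀⟩ := hlow
      refine ⟨F z₀, fun z hz => ?_⟩
      rcases hdiff z hz z₀ hz₀ with h | h | h
      · exact Or.inl (sub_eq_zero.mp h)
      · exact Or.inr (by linear_combination h)
      · rcases hdiff z hz c (by omega) with h' | h' | h'
        · exact Or.inr (by linear_combination h' - h₀)
        -- Here `F z = F c + 1` and `F z₀ = F c - 1`, so their difference is `2`; being `-1`, it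
        -- would force `3 = 0`.
        · exact absurd (show (3 : R) = 0 by linear_combination h - h' + h₀) h3
        · exact Or.inl (by linear_combination h' - h₀)
    · refine ⟨F c, fun z hz => ?_⟩
      rcases hdiff z hz c (by omega) with h | h | h
      · exact Or.inl (sub_eq_zero.mp h)
      · exact Or.inr (by linear_combination h)
      · exact absurd ⟨z, hz, by linear_combination h⟩ hlow
  classical
  -- On the other parity class `F` is `0`, which need not equal `a`, so `G` is only constant there;
  -- the wave sees only differences.
  refine ⟨fun z => if F z = a then 0 else 1, hF.comp (fun r => if r = a then (0 : ℤ) else 1),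
    fun z => ?_, fun z hz z' hz' => ?_, funext fun p => ?_⟩
  · dsimp only
    split_ifs <;> simp
  · simp only [hoff z hz, hoff z' hz']
  · have key : ∀ z z', (z + z') % 2 = 0 → F z - F z' =
        ((if F z = a then 0 else 1 : ℤ) : R) - ((if F z' = a then 0 else 1 : ℤ) : R) := by
      intro z z' hzz
      by_cases hz : (z + c) % 2 = 0
      · rcases ha z hz with h | h <;> rcases ha z' (by omega) with h' | h' <;> simp [h, h']
      · simp [hoff z hz, hoff z' (by omega)]
    simp only [castVec, rectWave, planeWave]
    by_cases h : (p.2.val : ℤ) % 2 = 0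
    · rw [if_pos h, if_pos h, key _ _ (by omega), Int.cast_sub]
    · rw [if_neg h, if_neg h, key _ _ (by omega), Int.cast_sub]

theorem eq_or_eq_neg_of_emod_two_eq {m n : ℕ} {s t : RectPt m n → ℤ} {c : ℤ}
    (hs : adjMap ℤ m n s = 0) (hsc : SupportedOnParity c s) (hss : HasSignCoords s)
    (ht : adjMap ℤ m n t = 0) (htc : SupportedOnParity c t) (hts : HasSignCoords t)
    (hst : ∀ p, s p % 2 = t p % 2) : t = s ∨ t = -s := by
  obtain ⟨G, hG, hG01, hGoff, hsG⟩ := exists_indicator_profile (by norm_num) hs hsc hss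
  obtain ⟨H, hH, hH01, hHoff, htH⟩ := exists_indicator_profile (by norm_num) ht htc hts
  have hsG' : ∀ p, s p = rectWave m n G p := fun p => by simpa [castVec] using congrFun hsG p
  have htH' : ∀ p, t p = rectWave m n H p := fun p => by simpa [castVec] using congrFun htH p
  -- `c` is itself a point of its parity class and serves as base point: modulo `2`, `G - H` is
  -- constant on that class.
  have key : ∀ z, (z + c) % 2 = 0 → ((G z - H z) - (G c - H c)) % 2 = 0 := by
    intro z hz
    refine (hG.sub hH).sub_mem (S := {r | r % 2 = 0}) (by simp) (fun r hr => ?_) (fun p => ?_) hz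
    · simp only [Set.mem_ofPred_eq] at hr ⊢
      omega
    · have h := hst p
      rw [hsG', htH'] at h
      simp only [rectWave, planeWave, Set.mem_ofPred_eq] at h ⊢
      split_ifs at h ⊢ <;> omega
  by_cases hcc : G c = H c
  · left
    funext p
    rw [hsG', htH']
    have hp : ∀ z, (z + c) % 2 = 0 → G z = H z := fun z hz => by
      have := key z hz
      have := hG01 z
      have := hH01 z
      omega
    by_cases hpar : ((p.1.val : ℤ) + p.2.val + c) % 2 = 0
    · simp only [rectWave, planeWave]
      rw [hp _ (by omega), hp _ (by omega)]
    · rw [← hsG', ← htH', hsc p hpar, htc p hpar]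
  · right
    funext p
    rw [Pi.neg_apply, hsG', htH']
    have hp : ∀ z, (z + c) % 2 = 0 → H z = 1 - G z := fun z hz => by
      have := key z hz
      have := hG01 z
      have := hH01 z
      have := hG01 c
      have := hH01 c
      omega
    by_cases hpar : ((p.1.val : ℤ) + p.2.val + c) % 2 = 0
    · simp only [rectWave, planeWave]
      rw [hp _ (by omega), hp _ (by omega)]
      split_ifs <;> ring
    · rw [← hsG', ← htH', hsc p hpar, htc p hpar, neg_zero]

/-! ### Alternating labellings and harmonic vectors -/

theorem isActive_castVec_iff {m n : ℕ} {s : RectPt m n → ℤ} (p : RectPt m n) :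
    IsActive (castVec (ZMod 2) s) p ↔ s p % 2 = 1 := by
  rw [IsActive, castVec]
  have := (ZMod.intCast_eq_intCast_iff' (s p) 1 2)
  simpa using this

theorem exists_offset_of_adj {m n : ℕ} {w p : RectPt m n} (h : (rectGraph m n).Adj w p) :
    ((p.1.val : ℤ) = w.1.val + 1 ∧ (p.2.val : ℤ) = w.2.val) ∨
      ((p.1.val : ℤ) = w.1.val - 1 ∧ (p.2.val : ℤ) = w.2.val) ∨
      ((p.1.val : ℤ) = w.1.val ∧ (p.2.val : ℤ) = w.2.val + 1) ∨
      ((p.1.val : ℤ) = w.1.val ∧ (p.2.val : ℤ) = w.2.val - 1) := by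
  simp only [rectGraph, Fin.ext_iff] at h
  omega

/-- At a right angle, `p` and `q` lie on a common diagonal and in rows of opposite parity. Their
wave values share one 0-1 term of `G`; as both are odd, the other two terms agree, and the row signs
make the values opposite. If `p` and `q` are the only active neighbors of `w`, harmonicity at `w`
suffices. -/
theorem isAlternating_castVec {m n : ℕ} {s : RectPt m n → ℤ} (hs : s ∈ polarizedKer ℤ m n)
    (hss : HasSignCoords s) : IsAlternating (castVec (ZMod 2) s) s := by
  obtain ⟨h0, c, hc⟩ := mem_polarizedKer_iff.mp hs
  refine ⟨fun p hp => ?_, fun p hp => ?_, ?_⟩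
  · rw [isActive_castVec_iff] at hp
    have := hss p
    omega
  · rw [isActive_castVec_iff] at hp
    have := hss p
    omega
  · rintro p q ⟨hpq, hp, hq, w, hwp, hwq, hw⟩
    rw [isActive_castVec_iff] at hp hq
    rcases hw with hw | hw
    · obtain ⟨G, hG, hG01, hGoff, hsG⟩ := exists_indicator_profile (by norm_num) h0 hc hss
      have hsG' : ∀ p, s p = rectWave m n G p := fun p => by
        simpa [castVec] using congrFun hsG p
      rw [hsG'] at hp hq ⊢
      rw [hsG']
      have hcoord : ((p.1.val : ℤ) + p.2.val = q.1.val + q.2.val ∨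
          (p.1.val : ℤ) - p.2.val = q.1.val - q.2.val) ∧ (p.2.val + q.2.val : ℤ) % 2 = 1 := by
        unfold RightAngleAt at hw
        rcases exists_offset_of_adj hwp with ⟨h1, h2⟩ | ⟨h1, h2⟩ | ⟨h1, h2⟩ | ⟨h1, h2⟩ <;>
        rcases exists_offset_of_adj hwq with ⟨h3, h4⟩ | ⟨h3, h4⟩ | ⟨h3, h4⟩ | ⟨h3, h4⟩ <;>
        rw [h1, h2, h3, h4] at hw ⊢ <;> ring_nf at hw <;> omega
      simp only [rectWave, planeWave] at hp hq ⊢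
      obtain ⟨hd, hpar⟩ := hcoord
      have g1 := hG01 (p.1.val + p.2.val + 2)
      have g2 := hG01 (p.1.val - p.2.val)
      have g3 := hG01 (q.1.val + q.2.val + 2)
      have g4 := hG01 (q.1.val - q.2.val)
      rcases hd with hd | hd
      · rw [hd] at hp g1 ⊢
        split_ifs at hp hq ⊢ <;> omega
      · rw [hd] at hp g2 ⊢
        split_ifs at hp hq ⊢ <;> omega
    · have hsum := congrFun h0 w
      rw [adjMap_apply_eq_sum, ← Finset.sum_subset (s₁ := {p, q}), Finset.sum_pair hpq] at hsum
      · rw [Pi.zero_apply] at hsum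
        omega
      · intro r hr
        rw [SimpleGraph.mem_neighborFinset]
        rcases Finset.mem_insert.mp hr with rfl | hr
        · exact hwp
        · rw [Finset.mem_singleton.mp hr]
          exact hwq
      · intro r hr hr'
        rw [SimpleGraph.mem_neighborFinset] at hr
        have hr'' := mt (hw r hr) (by simpa using hr')
        rw [isActive_castVec_iff] at hr''
        have := hss r
        omega

theorem IsAlternating.neg {m n : ℕ} {u : RectPt m n → ZMod 2} {s : RectPt m n → ℤ}
    (h : IsAlternating u s) : IsAlternating u (-s) where
  inactive p hp := by simp [h.inactive p hp]
  active p hp := by rcases h.active p hp with h | h <;> simp [h]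
  alternate p q hpq := by simp [h.alternate p q hpq]

theorem IsAlternating.hasSignCoords {m n : ℕ} {u : RectPt m n → ZMod 2} {s : RectPt m n → ℤ}
    (h : IsAlternating u s) : HasSignCoords s := by
  intro p
  by_cases hp : IsActive u p
  · exact Or.inr (h.active p hp)
  · exact Or.inl (h.inactive p hp)

theorem IsAlternating.isActive_iff {m n : ℕ} {u : RectPt m n → ZMod 2} {s : RectPt m n → ℤ}
    (h : IsAlternating u s) (p : RectPt m n) : IsActive u p ↔ s p % 2 = 1 := by
  constructor
  · intro hp
    have := h.active p hp
    omega
  · intro hp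
    by_contra hp'
    have := h.inactive p hp'
    omega

theorem SupportedOnParity.of_isAlternating {m n : ℕ} {u : RectPt m n → ZMod 2}
    {s : RectPt m n → ℤ} {c : ℤ} (hc : SupportedOnParity c u) (h : IsAlternating u s) :
    SupportedOnParity c s := fun p hp =>
  h.inactive p (by simp [IsActive, hc p hp])

theorem exists_rectPt_of_zeroExt_eq_one {m n : ℕ} {u : RectPt m n → ZMod 2} {a b : ℤ}
    (h : zeroExt u a b = 1) :
    ∃ p : RectPt m n, (p.1.val : ℤ) = a ∧ (p.2.val : ℤ) = b ∧ IsActive u p := by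
  rcases exists_rectPt_or_outside m n a b with ⟨p, h1, h2⟩ | h'
  · exact ⟨p, h1, h2, by rwa [zeroExt_apply u p h1 h2] at h⟩
  · rw [zeroExt_of_outside u h'] at h
    exact absurd h (by decide)

theorem IsAlternating.zeroExt_eq_zero {m n : ℕ} {u : RectPt m n → ZMod 2} {s : RectPt m n → ℤ}
    (h : IsAlternating u s) {a b : ℤ} (hu : zeroExt u a b = 0) : zeroExt s a b = 0 := by
  rcases exists_rectPt_or_outside m n a b with ⟨p, h1, h2⟩ | h'
  · rw [zeroExt_apply u p h1 h2] at hu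
    rw [zeroExt_apply s p h1 h2]
    exact h.inactive p (by simp [IsActive, hu])
  · exact zeroExt_of_outside s h'

theorem adj_of_offset {m n : ℕ} {w p : RectPt m n}
    (h : ((p.1.val : ℤ) = w.1.val + 1 ∧ (p.2.val : ℤ) = w.2.val) ∨
      ((p.1.val : ℤ) = w.1.val - 1 ∧ (p.2.val : ℤ) = w.2.val) ∨
      ((p.1.val : ℤ) = w.1.val ∧ (p.2.val : ℤ) = w.2.val + 1) ∨
      ((p.1.val : ℤ) = w.1.val ∧ (p.2.val : ℤ) = w.2.val - 1)) : (rectGraph m n).Adj w p := by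
  simp only [rectGraph, Fin.ext_iff]
  omega

/-- Active neighbors of `w` in a horizontal and a vertical direction get opposite labels. -/
theorem IsAlternating.zeroExt_of_rightAngle {m n : ℕ} {u : RectPt m n → ZMod 2}
    {s : RectPt m n → ℤ} (h : IsAlternating u s) (w : RectPt m n) {a b : ℤ}
    (ha : a = w.1.val + 1 ∨ a = w.1.val - 1) (hb : b = w.2.val + 1 ∨ b = w.2.val - 1)
    (h1 : zeroExt u a w.2.val = 1) (h2 : zeroExt u w.1.val b = 1) :
    zeroExt s w.1.val b = -zeroExt s a w.2.val := by
  obtain ⟨p, hp1, hp2, hp⟩ := exists_rectPt_of_zeroExt_eq_one h1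
  obtain ⟨q, hq1, hq2, hq⟩ := exists_rectPt_of_zeroExt_eq_one h2
  rw [zeroExt_apply s p hp1 hp2, zeroExt_apply s q hq1 hq2]
  refine h.alternate p q ⟨?_, hp, hq, w, adj_of_offset ?_, adj_of_offset ?_, Or.inl ?_⟩
  · rintro rfl
    omega
  · omega
  · omega
  · simp [RightAngleAt, hp2, hq1]

/-- If exactly two opposite neighbors of `w` are active, they get opposite labels. -/
theorem IsAlternating.zeroExt_of_opposite {m n : ℕ} {u : RectPt m n → ZMod 2}
    {s : RectPt m n → ℤ} (h : IsAlternating u s) (w : RectPt m n) {a b a' b' : ℤ}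
    (hab : (a = w.1.val + 1 ∧ b = w.2.val ∧ a' = w.1.val - 1 ∧ b' = w.2.val ∧
        zeroExt u w.1.val (w.2.val + 1) = 0 ∧ zeroExt u w.1.val (w.2.val - 1) = 0) ∨
      (a = w.1.val ∧ b = w.2.val + 1 ∧ a' = w.1.val ∧ b' = w.2.val - 1 ∧
        zeroExt u (w.1.val + 1) w.2.val = 0 ∧ zeroExt u (w.1.val - 1) w.2.val = 0))
    (h1 : zeroExt u a b = 1) (h2 : zeroExt u a' b' = 1) :
    zeroExt s a' b' = -zeroExt s a b := by
  obtain ⟨p, hp1, hp2, hp⟩ := exists_rectPt_of_zeroExt_eq_one h1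
  obtain ⟨q, hq1, hq2, hq⟩ := exists_rectPt_of_zeroExt_eq_one h2
  rw [zeroExt_apply s p hp1 hp2, zeroExt_apply s q hq1 hq2]
  refine h.alternate p q ⟨?_, hp, hq, w, adj_of_offset ?_, adj_of_offset ?_, Or.inr ?_⟩
  · rintro rfl
    omega
  · omega
  · omega
  · intro r hr hra
    have hout : ∀ {x y : ℤ}, (r.1.val : ℤ) = x → (r.2.val : ℤ) = y → zeroExt u x y = 0 → False := by
      intro x y hx hy h0
      rw [zeroExt_apply u r hx hy, hra] at h0
      exact absurd h0 (by decide)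
    simp only [Prod.ext_iff, Fin.ext_iff]
    rcases hab with ⟨e1, e2, e3, e4, z1, z2⟩ | ⟨e1, e2, e3, e4, z1, z2⟩ <;>
    rcases exists_offset_of_adj hr with ⟨h3, h4⟩ | ⟨h3, h4⟩ | ⟨h3, h4⟩ | ⟨h3, h4⟩ <;>
    first
      | exact (hout h3 h4 z1).elim
      | exact (hout h3 h4 z2).elim
      | omega

/-- An alternating labelling of a harmonic function modulo `2` is harmonic over `ℤ`. -/
theorem IsAlternating.adjMap_eq_zero {m n : ℕ} {u : RectPt m n → ZMod 2} {s : RectPt m n → ℤ}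
    (h : IsAlternating u s) (hu : adjMap (ZMod 2) m n u = 0) : adjMap ℤ m n s = 0 := by
  funext w
  have hsum := congrFun hu w
  rw [adjMap_eq_zeroExt, Pi.zero_apply] at hsum
  rw [adjMap_eq_zeroExt, Pi.zero_apply]
  have r1 := h.zeroExt_of_rightAngle w (Or.inl rfl) (Or.inl rfl)
  have r2 := h.zeroExt_of_rightAngle w (Or.inl rfl) (Or.inr rfl)
  have r3 := h.zeroExt_of_rightAngle w (Or.inr rfl) (Or.inl rfl)
  have r4 := h.zeroExt_of_rightAngle w (Or.inr rfl) (Or.inr rfl)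
  have o1 := fun z1 z2 => h.zeroExt_of_opposite w (Or.inl ⟨rfl, rfl, rfl, rfl, z1, z2⟩)
  have o2 := fun z1 z2 => h.zeroExt_of_opposite w (Or.inr ⟨rfl, rfl, rfl, rfl, z1, z2⟩)
  have z1 := h.zeroExt_eq_zero (a := w.1.val + 1) (b := w.2.val)
  have z2 := h.zeroExt_eq_zero (a := w.1.val - 1) (b := w.2.val)
  have z3 := h.zeroExt_eq_zero (a := w.1.val) (b := w.2.val + 1)
  have z4 := h.zeroExt_eq_zero (a := w.1.val) (b := w.2.val - 1)
  generalize zeroExt u (w.1.val + 1) w.2.val = A at *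
  generalize zeroExt u (w.1.val - 1) w.2.val = B at *
  generalize zeroExt u w.1.val (w.2.val + 1) = C at *
  generalize zeroExt u w.1.val (w.2.val - 1) = D at *
  have hz : ∀ x : ZMod 2, x = 0 ∨ x = 1 := by decide
  -- An even number of neighbors is active. Two cancel whether at a right angle or opposite; for
  -- four, both horizontal labels are opposite to both vertical ones.
  rcases hz A with rfl | rfl <;> rcases hz B with rfl | rfl <;> rcases hz C with rfl | rfl <;>
    rcases hz D with rfl | rfl <;> first
      | exact absurd hsum (by decide)
      | (simp only [forall_const, zero_ne_one, one_ne_zero, false_imp_iff] at *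
         omega)


/-! ### Liftings and the bijections -/

theorem exists_integral_lift {R : Type*} [CommRing R] [Nontrivial R] (h3 : (3 : R) ≠ 0) {m n : ℕ}
    {v : RectPt m n → R} (hv : v ∈ polarizedKer R m n) (hs : HasSignCoords v) :
    ∃ s ∈ polarizedKer ℤ m n, HasSignCoords s ∧ v = castVec R s := by
  obtain ⟨h0, c, hc⟩ := mem_polarizedKer_iff.mp hv
  obtain ⟨G, hG, hG01, hoff, hvG⟩ := exists_indicator_profile h3 h0 hc hs
  refine ⟨rectWave m n G, mem_polarizedKer_iff.mpr ⟨hG.adjMap_rectWave, c,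
    supportedOnParity_rectWave fun z hz => hoff z hz (c + 1) (by omega)⟩, fun p => ?_, hvG⟩
  have g1 := hG01 (p.1.val + p.2.val + 2)
  have g2 := hG01 (p.1.val - p.2.val)
  simp only [rectWave, planeWave]
  split_ifs <;> omega

theorem exists_isAlternating {m n : ℕ} {u : RectPt m n → ZMod 2}
    (hu : u ∈ polarizedKer (ZMod 2) m n) :
    ∃ s ∈ polarizedKer ℤ m n, HasSignCoords s ∧ IsAlternating u s := by
  have hz : ∀ x : ZMod 2, x = 0 ∨ x = 1 ∨ x = -1 := by decide
  obtain ⟨s, hs, hss, rfl⟩ := exists_integral_lift (by decide) hu fun p => hz (u p)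
  exact ⟨s, hs, hss, isAlternating_castVec hs hss⟩

theorem liftings_eq_pair (K : Type*) [CommRing K] {m n : ℕ} {u : RectPt m n → ZMod 2}
    (hu : u ∈ polarizedKer (ZMod 2) m n) {s : RectPt m n → ℤ} (hs : IsAlternating u s) :
    liftings K u = {castVec K s, -castVec K s} := by
  obtain ⟨h0, c, hc⟩ := mem_polarizedKer_iff.mp hu
  have hneg : castVec K (-s) = -castVec K s := by
    funext p
    simp [castVec]
  ext v
  simp only [liftings, Set.mem_ofPred_eq, Set.mem_insert_iff, Set.mem_singleton_iff]
  constructor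
  · rintro ⟨t, ht, rfl⟩
    have hst : ∀ p, s p % 2 = t p % 2 := fun p => by
      have h1 := hs.isActive_iff p
      have h2 := ht.isActive_iff p
      rw [h1] at h2
      omega
    rcases eq_or_eq_neg_of_emod_two_eq (hs.adjMap_eq_zero h0) (hc.of_isAlternating hs)
      hs.hasSignCoords (ht.adjMap_eq_zero h0) (hc.of_isAlternating ht) ht.hasSignCoords hst
      with rfl | rfl
    · exact Or.inl rfl
    · exact Or.inr hneg
  · rintro (rfl | rfl)
    · exact ⟨s, hs, rfl⟩
    · exact ⟨-s, hs.neg, hneg.symm⟩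

theorem IsAlternating.isActive_iff_castVec_ne_zero (K : Type*) [CommRing K] [Nontrivial K]
    {m n : ℕ} {u : RectPt m n → ZMod 2} {s : RectPt m n → ℤ} (h : IsAlternating u s)
    (p : RectPt m n) : IsActive u p ↔ castVec K s p ≠ 0 := by
  constructor
  · intro hp
    rcases h.active p hp with h' | h' <;> simp [castVec, h']
  · intro hp
    by_contra hp'
    exact hp (by simp [castVec, h.inactive p hp'])

/-- Injectivity holds because the support of any lifting is the active set, even when `1 = -1`; for
surjectivity, reduce the integral vector modulo `2`. -/
theorem bijOn_liftings_integralSignClasses (K : Type*) [CommRing K] [Nontrivial K] (m n : ℕ) :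
    Set.BijOn (liftings K) (polarizedKer (ZMod 2) m n) (integralSignClasses K m n) := by
  refine ⟨fun u hu => ?_, fun u hu u' hu' huu => ?_, ?_⟩
  · obtain ⟨s, hs, hss, hsu⟩ := exists_isAlternating hu
    exact ⟨s, hs, hss, liftings_eq_pair K hu hsu⟩
  · obtain ⟨s, -, -, hsu⟩ := exists_isAlternating hu
    have hmem : castVec K s ∈ liftings K u := ⟨s, hsu, rfl⟩
    rw [huu] at hmem
    obtain ⟨t, ht, hst⟩ := hmem
    funext p
    have h1 := hsu.isActive_iff_castVec_ne_zero K p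
    rw [hst, ← ht.isActive_iff_castVec_ne_zero K p] at h1
    have hz : ∀ x y : ZMod 2, (x = 1 ↔ y = 1) → x = y := by decide
    exact hz _ _ h1
  · rintro _ ⟨s, hs, hss, rfl⟩
    have hu := castVec_mem_polarizedKer (ZMod 2) hs
    exact ⟨_, hu, liftings_eq_pair K hu (isAlternating_castVec hs hss)⟩

theorem integralSignClasses_subset (K : Type*) [CommRing K] (m n : ℕ) :
    integralSignClasses K m n ⊆ signClasses K m n := by
  rintro _ ⟨s, hs, hss, rfl⟩
  exact ⟨_, castVec_mem_polarizedKer K hs, hss.castVec K, rfl⟩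

theorem signClasses_subset {K : Type*} [CommRing K] [Nontrivial K] (h3 : (3 : K) ≠ 0) (m n : ℕ) :
    signClasses K m n ⊆ integralSignClasses K m n := by
  rintro _ ⟨v, hv, hvs, rfl⟩
  obtain ⟨s, hs, hss, rfl⟩ := exists_integral_lift h3 hv hvs
  exact ⟨s, hs, hss, rfl⟩

theorem three_ne_zero_of_ringChar_ne {K : Type*} [Field K] (h : ringChar K ≠ 3) : (3 : K) ≠ 0 := by
  intro h0
  have hdvd : ringChar K ∣ 3 := (ringChar.spec K 3).mp (by exact_mod_cast h0)
  rcases (Nat.dvd_prime Nat.prime_three).mp hdvd with h1 | h1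
  · exact CharP.ringChar_ne_one h1
  · exact h h1

theorem theorem4 (K : Type*) [Field K] (m n : ℕ) :
    Set.BijOn (liftings K) (polarizedKer (ZMod 2) m n) (integralSignClasses K m n) ∧
      integralSignClasses K m n ⊆ signClasses K m n ∧
      (ringChar K ≠ 3 →
        Set.BijOn (liftings K) (polarizedKer (ZMod 2) m n) (signClasses K m n)) := by
  have hbij := bijOn_liftings_integralSignClasses K m n
  refine ⟨hbij, integralSignClasses_subset K m n, fun h => ?_⟩
  rwa [(signClasses_subset (three_ne_zero_of_ringChar_ne h) m n).antisymm
    (integralSignClasses_subset K m n)]
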